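/- **Model.** Time is slotted. One LLM engine has a token budget $b\in\mathbb N$, and a batch of $k$ tokens takes $t_k\ge 1$ slots ($k\mapsto t_k$ is an arbitrary function with positive integer values). It serves requests of two types $j\in\{1,2\}$. In each slot a finite ordered list of requests arrives; the lists of the types of these requests are i.i.d. over the slots, and $\lambda^j$ denotes the mean number of type-$j$ requests per slot. Independently of everything else, a type-$j$ request has a random triple (number of prefill tokens $v_p\ge 1$, number of decode tokens $v_d\ge 1$, feature in a finite set), with a law depending only on $j$; $m^j_p$ and $m^j_d$ are the means of $v_p$ and $v_d$. All of $\lambda^j,m^j_p,m^j_d$ are assumed finite. The state is $x=(r,(p_i,d_i,z_i)_{i\in\mathcal Q})$: $r$ is the remaining processing time of the current batch, and the requests present, each with its type, are listed from oldest to youngest with their numbers $p_i,d_i$ of not yet loaded prefill and decode tokens and their features $z_i$. A scheduling algorithm $\pi$ chooses, as a function of the state, numbers $(\delta^p_i,\delta^d_i)_{i\in\mathcal Q}$ of tokens to load, such that $\delta_i^d=0$ if $p_i>0$, $\delta^p_i\le p_i$, $\delta^d_i\le 1$, $b'=\sum_i(\delta^p_i+\delta^d_i)\le b$, and $b'=0$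 if $r>0$. Loaded tokens are subtracted, requests with no unprocessed decode tokens leave, the new requests of the slot are appended, and $r$ becomes $r-1$ if $r>0$ and $t_{b'}-1$ if $r=0$. This defines a discrete-time Markov chain. The algorithm is *$(K_p,K_d)$-FCFS* if prefill tokens are loaded only from the $K_p$ oldest requests with $p_i>0$, and decode tokens only from the $K_d$ oldest requests with $p_i=0$. It is *work-conserving* if, whenever $r=0$, the batch is full ($b'=b$) when $\sum_i(p_i+1(p_i=0))\ge b$, and contains all loadable tokens ($b'=\sum_i(p_i+1(p_i=0))$) otherwise. **Fluid model.** A fluid model solution consists of functions $B^j_f,F^j_f,W^j_f,Z^j_f$ on $[0,\infty)$, $j\in\{1,2\}$, $f\in\{p,d\}$, with $Z^j_f\ge 0$ and $$Z^j_p(t)=Z^j_p(0)+\lambda^jt-F^j_p(t),\qquad Z^j_d(t)=Z^j_d(0)+F^j_p(t)-F^j_d(t),$$ $$B^j_f(0)=0,\qquad 0\le B^j_f(t)-B^j_f(s)\le (t-s)\,b/t_b\ \ (0\le s\le t),\qquad F^j_f=B^j_f/m^j_f,\qquad W^j_f=m^j_fZ^j_f.$$ It is work-conserving if, at each $t>0$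 at which all components are differentiable, $\sum_{j}(W^j_p(t)+W^j_d(t))>0$ implies $\sum_{j}(\dot B^j_p(t)+\dot B^j_d(t))=b/t_b$. The fluid model (under work-conserving algorithms) is *stable* if there is $\delta>0$ such that every work-conserving fluid model solution with $\sum_{j}(Z^j_p(0)+Z^j_d(0))\le 1$ satisfies $Z^j_f(t)=0$ for all $j$, $f$ and all $t\ge\delta$. **Claim.** Assume $$\sum_{j\in\{1,2\}}\lambda^j(m^j_p+m^j_d)<b/t_b.$$ Then the fluid model is stable. Moreover, for all integers $K_p,K_d\ge 1$, every work-conserving $(K_p,K_d)$-FCFS algorithm and every initial state $x_0$, if the Markov chain is irreducible on the set $\mathcal X$ of states that it can reach from $x_0$, then it is positive recurrent: every state in $\mathcal X$ has a finite expected return time. (Feasibility, the FCFS property and work conservation are required only at the states in $\mathcal X$.) -/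

import Mathlib

open MeasureTheory ProbabilityTheory
open scoped ENNReal

/-! ### Markov chains on a discrete state space -/

namespace DTMC

/-- One-step kernel of the time-homogeneous chain with transition law `P`, as a kernel from
histories `(x₀, …, xₙ)` to the next state.  The state space carries the discrete `σ`-algebra. -/
noncomputable def stepKernel {S : Type*} [MeasurableSpace S] [DiscreteMeasurableSpace S]
    (P : S → PMF S) (n : ℕ) : Kernel ((i : Finset.Iic n) → S) S where
  toFun h := (P (h ⟨n, Finset.mem_Iic.2 le_rfl⟩)).toMeasure
  measurable' :=
    (Measurable.of_discrete (f := fun x : S => (P x).toMeasure)).comp (measurable_pi_apply _)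

instance {S : Type*} [MeasurableSpace S] [DiscreteMeasurableSpace S]
    (P : S → PMF S) (n : ℕ) : IsMarkovKernel (stepKernel P n) where
  isProbabilityMeasure h :=
    inferInstanceAs (IsProbabilityMeasure (P (h ⟨n, Finset.mem_Iic.2 le_rfl⟩)).toMeasure)

/-- The law on trajectories `ℕ → S` of the Markov chain with transition law `P` started at `x`. -/
noncomputable def pathLaw {S : Type*} [MeasurableSpace S] [DiscreteMeasurableSpace S]
    (P : S → PMF S) (x : S) : Measure (ℕ → S) :=
  Kernel.traj (X := fun _ => S) (stepKernel P) 0 (fun _ => x)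

/-- The first time `n ≥ 1` at which a trajectory is at `x` (`∞` if there is none). -/
noncomputable def returnTime {S : Type*} (x : S) (ω : ℕ → S) : ℝ≥0∞ :=
  ⨅ (n : ℕ) (_ : 1 ≤ n ∧ ω n = x), (n : ℝ≥0∞)

/-- Expected return time to `x` of the chain started at `x`. -/
noncomputable def meanReturnTime {S : Type*} [MeasurableSpace S] [DiscreteMeasurableSpace S]
    (P : S → PMF S) (x : S) : ℝ≥0∞ :=
  ∫⁻ ω, returnTime x ω ∂(pathLaw P x)

/-- The states that the chain started at `x` visits with positive probability. -/
def reachable {S : Type*} (P : S → PMF S) (x : S) : Set S :=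
  {y | Relation.ReflTransGen (fun u v => v ∈ (P u).support) x y}

/-- The chain started at `x₀` is irreducible: all states it can take communicate. -/
def IsIrreducibleFrom {S : Type*} (P : S → PMF S) (x₀ : S) : Prop :=
  ∀ x ∈ reachable P x₀, ∀ y ∈ reachable P x₀, y ∈ reachable P x

/-- The chain started at `x₀` is positive recurrent: each state it can take has a finite expected
return time. -/
def IsPositiveRecurrentFrom {S : Type*} [MeasurableSpace S] [DiscreteMeasurableSpace S]
    (P : S → PMF S) (x₀ : S) : Prop :=
  ∀ x ∈ reachable P x₀, meanReturnTime P x < ∞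

end DTMC

namespace LLM

/-- The two phases of a request. -/
inductive Phase where
  | prefill
  | decode

/-! ### The stochastic model: one engine, two request types -/

/-- A request in the system: its type, its numbers of unprocessed (not yet loaded) prefill and
decode tokens, and its feature. -/
structure Request (κ : Type*) where
  type : Fin 2
  prefill : ℕ
  decode : ℕ
  feature : κ

/-- System state at the beginning of a slot: the remaining processing time of the current batch,
and the requests that have not departed, listed from the oldest to the youngest. -/
structure State (κ : Type*) where
  remaining : ℕ
  queue : List (Request κ)

instance {κ : Type*} : MeasurableSpace (State κ) := ⊤

instance {κ : Type*} : DiscreteMeasurableSpace (State κ) := ⟨fun _ => trivial⟩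

/-- Primitive data of an engine serving two types of requests. -/
structure Engine (κ : Type*) where
  /-- token budget `b` -/
  budget : ℕ
  /-- `batchTime k` is the number of slots needed to process a batch with `k` tokens -/
  batchTime : ℕ → ℕ
  batchTime_pos : ∀ k, 1 ≤ batchTime k
  /-- law of the list of the types of the requests arriving in one slot, in order of arrival -/
  arrivalLaw : PMF (List (Fin 2))
  /-- law of (prefill tokens, decode tokens, feature) of a request of a given type -/
  sizeLaw : Fin 2 → PMF (ℕ × ℕ × κ)
  prefill_pos : ∀ j, ∀ s ∈ (sizeLaw j).support, 1 ≤ s.1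
  decode_pos : ∀ j, ∀ s ∈ (sizeLaw j).support, 1 ≤ s.2.1

/-- Mean, in `[0, ∞]`, of the function `g` under the law `μ`. -/
noncomputable def pmfMean {α : Type*} (μ : PMF α) (g : α → ℕ) : ℝ≥0∞ :=
  ∑' a, μ a * (g a : ℝ≥0∞)

/-- A scheduling algorithm assigns to each state the numbers `(δᵖ, δᵈ)` of prefill and decode
tokens of each request that are loaded into a batch. -/
abbrev Algorithm (κ : Type*) := (x : State κ) → Fin x.queue.length → ℕ × ℕ

/-- Number `b'` of tokens loaded in state `x`. -/
def tokenLoad {κ : Type*} (π : Algorithm κ) (x : State κ) : ℕ :=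
  ∑ i, ((π x i).1 + (π x i).2)

/-- Number of tokens that could be loaded in state `x` if there were no token budget: all the
unprocessed prefill tokens, and one decode token of each request in the decode phase. -/
def loadable {κ : Type*} (x : State κ) : ℕ :=
  ∑ i : Fin x.queue.length, (x.queue[i].prefill + if x.queue[i].prefill = 0 then 1 else 0)

/-- Feasibility of the decision in state `x` under token budget `b`. -/
structure IsFeasibleAt {κ : Type*} (b : ℕ) (π : Algorithm κ) (x : State κ) : Prop where
  busy : 0 < x.remaining → tokenLoad π x = 0
  prefill_first : ∀ i, 0 < x.queue[i].prefill → (π x i).2 = 0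
  prefill_le : ∀ i, (π x i).1 ≤ x.queue[i].prefill
  decode_le : ∀ i, (π x i).2 ≤ 1
  budget : tokenLoad π x ≤ b

/-- Work conservation in state `x`: when a batch can be formed, it is full if there are enough
loadable tokens, and otherwise no loadable token is left out. -/
structure IsWorkConservingAt {κ : Type*} (b : ℕ) (π : Algorithm κ) (x : State κ) : Prop where
  full : x.remaining = 0 → b ≤ loadable x → tokenLoad π x = b
  exhaustive : x.remaining = 0 → loadable x < b → tokenLoad π x = loadable x

/-- `(K_p, K_d)`-FCFS in state `x`: prefill tokens are loaded only from the `K_p` oldest requests in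
the prefill phase, decode tokens only from the `K_d` oldest requests in the decode phase. -/
structure IsFCFSAt {κ : Type*} (Kp Kd : ℕ) (π : Algorithm κ) (x : State κ) : Prop where
  prefill : ∀ i, 0 < (π x i).1 →
    (Finset.univ.filter fun k => k < i ∧ 0 < x.queue[k].prefill).card < Kp
  decode : ∀ i, 0 < (π x i).2 →
    (Finset.univ.filter fun k => k < i ∧ x.queue[k].prefill = 0).card < Kd

/-- The requests present after the decision in state `x`: loaded tokens are subtracted, and the
requests without unprocessed decode tokens are removed. -/
def postQueue {κ : Type*} (π : Algorithm κ) (x : State κ) : List (Request κ) :=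
  (List.ofFn fun i : Fin x.queue.length =>
    { x.queue[i] with
      prefill := x.queue[i].prefill - (π x i).1
      decode := x.queue[i].decode - (π x i).2 }).filter fun r => r.decode ≠ 0

namespace Engine

variable {κ : Type*}

/-- Arrival rate `λʲ` of type `j`, in `[0, ∞]`. -/
noncomputable def erate (M : Engine κ) (j : Fin 2) : ℝ≥0∞ :=
  pmfMean M.arrivalLaw fun l => l.count j

/-- Mean token sizes `mʲ_p` and `mʲ_d` of type `j`, in `[0, ∞]`. -/
noncomputable def emeanSize (M : Engine κ) (j : Fin 2) : Phase → ℝ≥0∞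
  | .prefill => pmfMean (M.sizeLaw j) fun s => s.1
  | .decode => pmfMean (M.sizeLaw j) fun s => s.2.1

/-- First-moment assumption. -/
structure FiniteMeans (M : Engine κ) : Prop where
  rate : ∀ j, M.erate j ≠ ∞
  size : ∀ j f, M.emeanSize j f ≠ ∞

/-- Arrival rate `λʲ` as a real number. -/
noncomputable def rate (M : Engine κ) (j : Fin 2) : ℝ := (M.erate j).toReal

/-- Mean token size `mʲ_f` as a real number. -/
noncomputable def meanSize (M : Engine κ) (j : Fin 2) (f : Phase) : ℝ := (M.emeanSize j f).toReal

/-- Maximal token processing rate `b / t_b`. -/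
noncomputable def capacity (M : Engine κ) : ℝ := (M.budget : ℝ) / (M.batchTime M.budget : ℝ)

/-- Law of the requests arriving in a slot, given their types: the sizes and features are
independent, those of a request of type `j` having law `sizeLaw j`. -/
noncomputable def drawRequests (M : Engine κ) : List (Fin 2) → PMF (List (Request κ))
  | [] => PMF.pure []
  | j :: js =>
    (M.sizeLaw j).bind fun s => (drawRequests M js).map fun l => ⟨j, s.1, s.2.1, s.2.2⟩ :: l

/-- Law of the list of requests arriving in one slot. -/
noncomputable def newRequests (M : Engine κ) : PMF (List (Request κ)) :=
  M.arrivalLaw.bind M.drawRequests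

/-- Remaining processing time at the beginning of the next slot. -/
def nextRemaining (M : Engine κ) (π : Algorithm κ) (x : State κ) : ℕ :=
  if 0 < x.remaining then x.remaining - 1 else M.batchTime (tokenLoad π x) - 1

/-- Transition law of the Markov chain describing the engine under the algorithm `π`. -/
noncomputable def transition (M : Engine κ) (π : Algorithm κ) (x : State κ) : PMF (State κ) :=
  M.newRequests.map fun new => ⟨M.nextRemaining π x, postQueue π x ++ new⟩

end Engine

/-! ### The fluid model -/

/-- The components `B, F, W, Z` of a fluid model solution, indexed by the type, the phase and the
time `t`; only times `t ≥ 0` matter. -/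
structure FluidPath where
  B : Fin 2 → Phase → ℝ → ℝ
  F : Fin 2 → Phase → ℝ → ℝ
  W : Fin 2 → Phase → ℝ → ℝ
  Z : Fin 2 → Phase → ℝ → ℝ

/-- Fluid model equations with arrival rates `rate j`, mean token sizes `m j f` and maximal token
processing rate `c`. -/
structure IsFluidSolution (rate : Fin 2 → ℝ) (m : Fin 2 → Phase → ℝ) (c : ℝ) (X : FluidPath) :
    Prop where
  Z_nonneg : ∀ j f t, 0 ≤ t → 0 ≤ X.Z j f t
  Z_prefill : ∀ j t, 0 ≤ t →
    X.Z j .prefill t = X.Z j .prefill 0 + rate j * t - X.F j .prefill t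
  Z_decode : ∀ j t, 0 ≤ t →
    X.Z j .decode t = X.Z j .decode 0 + X.F j .prefill t - X.F j .decode t
  B_zero : ∀ j f, X.B j f 0 = 0
  B_mono : ∀ j f s t, 0 ≤ s → s ≤ t → 0 ≤ X.B j f t - X.B j f s
  B_rate : ∀ j f s t, 0 ≤ s → s ≤ t → X.B j f t - X.B j f s ≤ (t - s) * c
  F_eq : ∀ j f t, 0 ≤ t → X.F j f t = 1 / m j f * X.B j f t
  W_eq : ∀ j f t, 0 ≤ t → X.W j f t = m j f * X.Z j f t

/-- `t > 0` is a regular point if all components are differentiable at `t`. -/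
def FluidPath.IsRegular (X : FluidPath) (t : ℝ) : Prop :=
  0 < t ∧ ∀ j f, DifferentiableAt ℝ (X.B j f) t ∧ DifferentiableAt ℝ (X.F j f) t ∧
    DifferentiableAt ℝ (X.W j f) t ∧ DifferentiableAt ℝ (X.Z j f) t

/-- Work conservation: tokens are processed at the maximal rate `c` whenever there are any. -/
def FluidPath.IsWorkConserving (c : ℝ) (X : FluidPath) : Prop :=
  ∀ t, X.IsRegular t → 0 < ∑ j, (X.W j .prefill t + X.W j .decode t) →
    ∑ j, (deriv (X.B j .prefill) t + deriv (X.B j .decode) t) = c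

/-- Stability of the work-conserving fluid model. -/
def FluidModelStable (rate : Fin 2 → ℝ) (m : Fin 2 → Phase → ℝ) (c : ℝ) : Prop :=
  ∃ δ : ℝ, 0 < δ ∧ ∀ X : FluidPath, IsFluidSolution rate m c X → X.IsWorkConserving c →
    ∑ j, (X.Z j .prefill 0 + X.Z j .decode 0) ≤ 1 → ∀ t, δ ≤ t → ∀ j f, X.Z j f t = 0

end LLM

/-!
Positive recurrence follows from Foster's criterion. Let `c = b / t_b`, let `L` be large, let `β` be
at least the cost `c * t_k` of every batch, and consider the number of unprocessed tokens, plus `β`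
times the excess over `L` of the largest request, plus `c` times the remaining time of the batch.
While a batch is running, the last term drops by `c` in each slot. When a batch starts, that term
grows by `c * (t_k - 1)`, which is made up for by the `b = c * t_b` tokens of a full batch; a batch
that is not full takes a token from every request, hence lowers a positive excess by one, that is,
by `β`. Meanwhile the arrivals of a slot add the load, which is less than `c`, plus `β` times the
mean excess over `L` of the arriving tokens, which tends to `0` as `L → ∞`. So there is a negative
drift unless a batch starts with fewer than `b` loadable tokens and no request exceeds `L`, which
leaves finitely many states.

For Foster's criterion, let `F` be the finite exceptional set and let `m` be the largest truncated
mean return time to `x` from a state of `F`. The drift bounds the truncated return time from `y` by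
`V y + m`. By irreducibility the chain started in `F` has, for suitable `k`, visited `x` by the time
`k` with probability at least `1 - a > 0`. Hence `m ≤ D + a * m` with `D` independent of the
truncation, and `m ≤ D / (1 - a)`.

In the fluid model, the number of tokens that the fluid present still requires grows at the rate of
the load and shrinks at the rate `c` as long as it is positive, so it vanishes within a time
proportional to its initial value.
-/

/-! ### Foster's criterion -/

namespace DTMC

/-- Integral of a `[0, ∞]`-valued function against a discrete law, as a linear map in the
function.  Unlike the Lebesgue integral it needs no `σ`-algebra. -/
noncomputable def expect {α : Type*} (μ : PMF α) : (α → ℝ≥0∞) →ₗ[ℝ≥0∞] ℝ≥0∞ where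
  toFun g := ∑' a, μ a * g a
  map_add' g h := by simp only [Pi.add_apply, mul_add, ENNReal.tsum_add]
  map_smul' c g := by
    simp only [Pi.smul_apply, smul_eq_mul, mul_left_comm, ENNReal.tsum_mul_left, RingHom.id_apply]

section Expect

variable {α β : Type*} (μ : PMF α)

lemma expect_apply (g : α → ℝ≥0∞) : expect μ g = ∑' a, μ a * g a := rfl

lemma expect_add (g h : α → ℝ≥0∞) : expect μ (fun a => g a + h a) = expect μ g + expect μ h :=
  map_add (expect μ) g h

lemma expect_const_mul (c : ℝ≥0∞) (g : α → ℝ≥0∞) :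
    expect μ (fun a => c * g a) = c * expect μ g :=
  map_smul (expect μ) c g

lemma expect_mono_support {g h : α → ℝ≥0∞} (hgh : ∀ a ∈ μ.support, g a ≤ h a) :
    expect μ g ≤ expect μ h := by
  refine ENNReal.tsum_le_tsum fun a => ?_
  by_cases ha : μ a = 0
  · simp [ha]
  · gcongr
    exact hgh a ((μ.mem_support_iff a).2 ha)

lemma expect_congr_support {g h : α → ℝ≥0∞} (hgh : ∀ a ∈ μ.support, g a = h a) :
    expect μ g = expect μ h :=
  (expect_mono_support μ fun a ha => (hgh a ha).le).antisymm
    (expect_mono_support μ fun a ha => (hgh a ha).ge)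

lemma expect_mono : Monotone (expect μ) :=
  fun _ _ hgh => expect_mono_support μ fun a _ => hgh a

lemma expect_one : expect μ 1 = 1 := by
  simp [expect_apply, μ.tsum_coe]

lemma expect_const (c : ℝ≥0∞) : expect μ (fun _ => c) = c := by
  simp [expect_apply, ENNReal.tsum_mul_right, μ.tsum_coe]

lemma expect_pure (a : α) (g : α → ℝ≥0∞) : expect (PMF.pure a) g = g a := by
  rw [expect_apply, tsum_eq_single a fun b hb => by simp [hb]]
  simp

lemma expect_bind (f : α → PMF β) (g : β → ℝ≥0∞) :
    expect (μ.bind f) g = expect μ fun a => expect (f a) g := by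
  simp only [expect_apply, PMF.bind_apply, ← ENNReal.tsum_mul_right, ← ENNReal.tsum_mul_left,
    mul_assoc]
  exact ENNReal.tsum_comm

lemma expect_map (f : α → β) (g : β → ℝ≥0∞) : expect (μ.map f) g = expect μ (g ∘ f) := by
  rw [PMF.map, expect_bind]
  exact congrArg _ (funext fun a => expect_pure (f a) g)

lemma lintegral_toMeasure [MeasurableSpace α] [DiscreteMeasurableSpace α] (g : α → ℝ≥0∞) :
    ∫⁻ a, g a ∂μ.toMeasure = expect μ g := by
  rw [← μ.restrict_toMeasure_support, lintegral_countable _ μ.support_countable,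
    tsum_subtype μ.support fun a => g a * μ.toMeasure {a}, expect_apply]
  refine tsum_congr fun a => ?_
  by_cases ha : a ∈ μ.support
  · rw [Set.indicator_of_mem ha, μ.toMeasure_apply_singleton a (MeasurableSet.singleton a),
      mul_comm]
  · rw [Set.indicator_of_notMem ha, (μ.apply_eq_zero_iff a).2 ha, zero_mul]

lemma expect_lt_one {g : α → ℝ≥0∞} (hg : g ≤ 1) {a : α} (ha : a ∈ μ.support) (hga : g a < 1) :
    expect μ g < 1 := by
  rw [← expect_one μ]
  refine ENNReal.tsum_lt_tsum (i := a) ?_ (fun b => by gcongr; exact hg b) ?_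
  · exact ((expect_mono μ hg).trans_lt (by simp [expect_one])).ne
  · exact ENNReal.mul_lt_mul_right ((μ.mem_support_iff a).1 ha) (μ.apply_ne_top a) hga

lemma exists_expect_tsub_le (g : α → ℕ) (hg : expect μ (fun a => g a) ≠ ∞) {ε : ℝ≥0∞}
    (hε : ε ≠ 0) : ∃ L : ℕ, expect μ (fun a => (g a - L : ℕ)) ≤ ε := by
  obtain ⟨s, hs⟩ := ((tendsto_order.1 (ENNReal.tendsto_tsum_compl_atTop_zero hg)).2 ε
    (pos_iff_ne_zero.2 hε)).exists
  refine ⟨s.sup g, ?_⟩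
  calc expect μ (fun a => (g a - s.sup g : ℕ))
      ≤ ∑' a, {a | a ∉ s}.indicator (fun a => μ a * g a) a := ENNReal.tsum_le_tsum fun a => ?_
    _ = ∑' a : {a // a ∉ s}, μ a * g a := (tsum_subtype _ _).symm
    _ ≤ ε := hs.le
  by_cases ha : a ∈ s
  · simp [Nat.sub_eq_zero_of_le (Finset.le_sup (f := g) ha)]
  · rw [Set.indicator_of_mem (show a ∈ {a | a ∉ s} from ha)]
    gcongr
    exact Nat.cast_le.2 (Nat.sub_le _ _)

end Expect

section Taboo

variable {S : Type*} (P : S → PMF S) (x : S)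

/-- Taboo transition operator: one step of the chain, killed when it enters `x`. -/
noncomputable def taboo : (S → ℝ≥0∞) →ₗ[ℝ≥0∞] (S → ℝ≥0∞) where
  toFun u y := expect (P y) (({x}ᶜ : Set S).indicator u)
  map_add' u v := by
    ext y
    rw [Set.indicator_add', map_add, Pi.add_apply]
  map_smul' c u := by
    ext y
    exact (congrArg _ (Set.indicator_const_smul _ c u)).trans (map_smul _ c _)

lemma taboo_mono : Monotone (taboo P x) :=
  fun _ _ huv y => expect_mono (P y) (Set.indicator_mono huv)

lemma taboo_le_expect (u : S → ℝ≥0∞) (y : S) : taboo P x u y ≤ expect (P y) u :=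
  expect_mono (P y) (Set.indicator_le_self _ u)

lemma taboo_pow_succ_apply (n : ℕ) (u : S → ℝ≥0∞) (y : S) :
    (taboo P x ^ (n + 1)) u y = taboo P x ((taboo P x ^ n) u) y := by
  rw [pow_succ', Module.End.mul_apply]

lemma taboo_pow_mono (n : ℕ) : Monotone (taboo P x ^ n) := by
  rw [Module.End.coe_pow]
  exact (taboo_mono P x).iterate n

lemma taboo_pow_one_le_one (n : ℕ) : (taboo P x ^ n) 1 ≤ 1 := by
  induction n with
  | zero => rfl
  | succ n ih =>
    intro y
    calc (taboo P x ^ (n + 1)) 1 y = taboo P x ((taboo P x ^ n) 1) y :=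
          taboo_pow_succ_apply P x n 1 y
      _ ≤ taboo P x 1 y := taboo_mono P x ih y
      _ ≤ expect (P y) 1 := taboo_le_expect P x 1 y
      _ = 1 := expect_one (P y)

variable {P x} in
lemma exists_taboo_pow_one_lt_one {y : S}
    (hyx : Relation.TransGen (fun u v => v ∈ (P u).support) y x) :
    ∃ k, (taboo P x ^ k) 1 y < 1 := by
  suffices ∀ {u v k}, v ∈ (P u).support → ({x}ᶜ : Set S).indicator ((taboo P x ^ k) 1) v < 1 →
      (taboo P x ^ (k + 1)) 1 u < 1 by
    induction hyx using Relation.TransGen.head_induction_on with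
    | single hux => exact ⟨1, this (k := 0) hux (by simp)⟩
    | head huv _ ih =>
      obtain ⟨k, hk⟩ := ih
      exact ⟨k + 1, this huv ((Set.indicator_le_self _ _ _).trans_lt hk)⟩
  intro u v k huv hv
  rw [taboo_pow_succ_apply]
  exact expect_lt_one (P u)
    ((Set.indicator_le_self _ _).trans (taboo_pow_one_le_one P x k)) huv hv

/-- Expectation, for the chain started at `y`, of the first return time to `x` truncated at `n`. -/
noncomputable def truncReturn (n : ℕ) : S → ℝ≥0∞ := ∑ k ∈ Finset.range n, (taboo P x ^ k) 1

lemma truncReturn_add (k n : ℕ) :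
    truncReturn P x (k + n) = truncReturn P x k + (taboo P x ^ k) (truncReturn P x n) := by
  simp only [truncReturn, Finset.sum_range_add, pow_add, Module.End.mul_apply, map_sum]

lemma truncReturn_succ (n : ℕ) (y : S) :
    truncReturn P x (n + 1) y = 1 + taboo P x (truncReturn P x n) y := by
  rw [add_comm n, truncReturn_add]
  simp [truncReturn]

lemma truncReturn_mono : Monotone (truncReturn P x) :=
  fun _ _ hmn => Finset.sum_le_sum_of_subset (Finset.range_mono hmn)

lemma truncReturn_le (n : ℕ) (y : S) : truncReturn P x n y ≤ n := by
  rw [truncReturn, Finset.sum_apply]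
  simpa using Finset.sum_le_card_nsmul (Finset.range n) (fun k => (taboo P x ^ k) 1 y) 1
    fun k _ => taboo_pow_one_le_one P x k y

end Taboo

section Foster

variable {S : Type*} {P : S → PMF S} {V : S → ℝ≥0∞} {F : Finset S} {C : ℝ≥0∞}

lemma truncReturn_le_add_sup (hdrift : ∀ y ∉ F, expect (P y) V + 1 ≤ V y) (x : S) (n : ℕ) :
    truncReturn P x n ≤ V + fun _ => F.sup (truncReturn P x n) := by
  induction n with
  | zero => simp [truncReturn]
  | succ n ih =>
    intro y
    by_cases hyF : y ∈ F
    · exact (Finset.le_sup (f := truncReturn P x (n + 1)) hyF).trans le_add_self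
    set m := F.sup (truncReturn P x n)
    calc truncReturn P x (n + 1) y
        = 1 + taboo P x (truncReturn P x n) y := truncReturn_succ P x n y
      _ ≤ 1 + expect (P y) (V + fun _ => m) := by
          gcongr
          exact (taboo_mono P x ih y).trans (taboo_le_expect P x _ y)
      _ = expect (P y) V + 1 + m := by rw [map_add, expect_const]; ring
      _ ≤ V y + F.sup (truncReturn P x (n + 1)) := by
          gcongr
          · exact hdrift y hyF
          · exact Finset.sup_mono_fun fun z _ => truncReturn_mono P x n.le_succ z

lemma taboo_pow_le_add_mul (hstep : ∀ y, expect (P y) V ≤ V y + C) (x : S) (k : ℕ) :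
    (taboo P x ^ k) V ≤ V + fun _ => k * C := by
  induction k with
  | zero => simp
  | succ k ih =>
    intro y
    calc (taboo P x ^ (k + 1)) V y
        = taboo P x ((taboo P x ^ k) V) y := taboo_pow_succ_apply P x k V y
      _ ≤ expect (P y) (V + fun _ => k * C) :=
          (taboo_mono P x ih y).trans (taboo_le_expect P x _ y)
      _ = expect (P y) V + k * C := by rw [map_add, expect_const]
      _ ≤ V y + C + k * C := by gcongr; exact hstep y
      _ = V y + (k + 1 : ℕ) * C := by push_cast; ring

lemma truncReturn_le_add_taboo_pow_mul_sup (hdrift : ∀ y ∉ F, expect (P y) V + 1 ≤ V y)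
    (hstep : ∀ y, expect (P y) V ≤ V y + C) (x : S) (k n : ℕ) (y : S) :
    truncReturn P x n y
      ≤ k + (V y + k * C) + (taboo P x ^ k) 1 y * F.sup (truncReturn P x n) := by
  set m := F.sup (truncReturn P x n)
  have hm : (fun _ => m : S → ℝ≥0∞) = m • 1 := by ext; simp
  calc truncReturn P x n y
      ≤ truncReturn P x (k + n) y := truncReturn_mono P x (Nat.le_add_left n k) y
    _ = truncReturn P x k y + (taboo P x ^ k) (truncReturn P x n) y := by
        rw [truncReturn_add, Pi.add_apply]
    _ ≤ k + (taboo P x ^ k) (V + m • 1) y := by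
        gcongr
        · exact truncReturn_le P x k y
        · exact taboo_pow_mono P x k (hm ▸ truncReturn_le_add_sup hdrift x n) y
    _ = k + (taboo P x ^ k) V y + (taboo P x ^ k) 1 y * m := by
        rw [map_add, map_smul, Pi.add_apply, Pi.smul_apply, smul_eq_mul, mul_comm m, add_assoc]
    _ ≤ k + (V y + k * C) + (taboo P x ^ k) 1 y * m := by
        gcongr
        exact taboo_pow_le_add_mul hstep x k y

lemma le_div_one_sub_of_le_add_mul {m D a : ℝ≥0∞} (ha : a < 1) (hm : m ≠ ∞)
    (h : m ≤ D + a * m) : m ≤ D / (1 - a) := by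
  rw [ENNReal.le_div_iff_mul_le (.inl (tsub_pos_of_lt ha).ne') (.inl (by simp)), mul_comm,
    ENNReal.sub_mul fun _ _ => hm, one_mul]
  exact tsub_le_iff_right.2 h

lemma exists_sup_truncReturn_le (hdrift : ∀ y ∉ F, expect (P y) V + 1 ≤ V y)
    (hstep : ∀ y, expect (P y) V ≤ V y + C) (hC : C ≠ ∞) (hV : ∀ y ∈ F, V y ≠ ∞) {x : S}
    (hx : ∀ y ∈ F, ∃ k, (taboo P x ^ k) 1 y < 1) :
    ∃ B ≠ ∞, ∀ n, F.sup (truncReturn P x n) ≤ B := by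
  choose! k hk using hx
  set D := F.sup fun y => k y + (V y + k y * C)
  set a := F.sup fun y => (taboo P x ^ k y) 1 y
  have ha : a < 1 := (Finset.sup_lt_iff (by simp)).2 hk
  have hD : D < ∞ := (Finset.sup_lt_iff (by simp)).2 fun y hy => by
    simp [lt_top_iff_ne_top, hV y hy, hC, ENNReal.mul_eq_top]
  refine ⟨D / (1 - a), ENNReal.div_ne_top hD.ne (tsub_pos_of_lt ha).ne', fun n => ?_⟩
  refine le_div_one_sub_of_le_add_mul ha ?_ (Finset.sup_le fun y hy => ?_)
  · exact ((Finset.sup_le fun y _ => truncReturn_le P x n y).trans_lt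
      (ENNReal.natCast_lt_top n)).ne
  · calc truncReturn P x n y
        ≤ k y + (V y + k y * C) + (taboo P x ^ k y) 1 y * F.sup (truncReturn P x n) :=
          truncReturn_le_add_taboo_pow_mul_sup hdrift hstep x (k y) n y
      _ ≤ D + a * F.sup (truncReturn P x n) := by
          gcongr
          · exact Finset.le_sup (f := fun y => k y + (V y + k y * C)) hy
          · exact Finset.le_sup (f := fun y => (taboo P x ^ k y) 1 y) hy

end Foster

section PathLaw

variable {S : Type*}

/-- The trajectories that do not visit `x` at the times `1, …, n`. -/
def avoiding (x : S) (n : ℕ) : Set (ℕ → S) := ⋂ i < n, (fun ω => ω (i + 1)) ⁻¹' {x}ᶜ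

lemma avoiding_zero (x : S) : avoiding x 0 = Set.univ := by simp [avoiding]

lemma avoiding_succ (x : S) (n : ℕ) :
    avoiding x (n + 1) = (fun ω => ω (n + 1)) ⁻¹' {x}ᶜ ∩ avoiding x n := by
  rw [avoiding, Set.biInter_lt_succ, Set.inter_comm, avoiding]

lemma returnTime_le_tsum_indicator_avoiding (x : S) (ω : ℕ → S) :
    returnTime x ω ≤ ∑' n, (avoiding x n).indicator 1 ω := by
  classical
  by_cases h : ∃ n, ω (n + 1) = x
  · set N := Nat.find h
    have hmem : ∀ n ∈ Finset.range (N + 1), ω ∈ avoiding x n := fun n hn =>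
      Set.mem_iInter₂.2 fun i hi => Nat.find_min h (hi.trans_le (Finset.mem_range_succ_iff.1 hn))
    calc returnTime x ω ≤ ((N + 1 : ℕ) : ℝ≥0∞) :=
          iInf₂_le (N + 1) ⟨Nat.le_add_left 1 N, Nat.find_spec h⟩
      _ = ∑ n ∈ Finset.range (N + 1), (avoiding x n).indicator 1 ω := by
          rw [Finset.sum_congr rfl fun n hn => Set.indicator_of_mem (hmem n hn) 1]
          simp
      _ ≤ _ := ENNReal.sum_le_tsum _
  · push Not at h
    have hmem : ∀ n, ω ∈ avoiding x n := fun n => Set.mem_iInter₂.2 fun i _ => h i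
    simp [Set.indicator_of_mem (hmem _)]

variable [MeasurableSpace S] [DiscreteMeasurableSpace S] (P : S → PMF S)

lemma measurableSet_piLE_avoiding (x : S) (n : ℕ) :
    MeasurableSet[Filtration.piLE (X := fun _ : ℕ => S) n] (avoiding x n) :=
  .iInter fun i => .iInter fun hi =>
    ⟨(fun h => h ⟨i + 1, hi⟩) ⁻¹' {x}ᶜ, measurable_pi_apply _ .of_discrete, rfl⟩

lemma measurableSet_avoiding (x : S) (n : ℕ) : MeasurableSet (avoiding x n) :=
  Filtration.piLE.le n _ (measurableSet_piLE_avoiding x n)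

lemma lintegral_pathLaw_zero (x₀ : S) (u : S → ℝ≥0∞) :
    ∫⁻ ω, u (ω 0) ∂pathLaw P x₀ = u x₀ := by
  have hu : Measurable u := .of_discrete
  calc ∫⁻ ω, u (ω 0) ∂pathLaw P x₀
      = ∫⁻ h, u (h ⟨0, Finset.mem_Iic.2 le_rfl⟩) ∂((pathLaw P x₀).map
          (Preorder.frestrictLe (π := fun _ => S) 0)) := by
        rw [lintegral_map (by fun_prop) (by fun_prop)]
        rfl
    _ = u x₀ := by
        rw [pathLaw, Kernel.traj_map_frestrictLe_apply, Kernel.partialTraj_self, Kernel.id_apply,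
          lintegral_dirac' _ (by fun_prop)]

lemma setLIntegral_pathLaw_succ (x₀ : S) {n : ℕ} {A : Set (ℕ → S)}
    (hA : MeasurableSet[Filtration.piLE (X := fun _ => S) n] A) (u : S → ℝ≥0∞) :
    ∫⁻ ω in A, u (ω (n + 1)) ∂pathLaw P x₀ = ∫⁻ ω in A, expect (P (ω n)) u ∂pathLaw P x₀ := by
  have hu : Measurable u := .of_discrete
  have hPu : Measurable fun y => expect (P y) u := .of_discrete
  rw [Filtration.piLE_eq_comap_frestrictLe] at hA
  obtain ⟨A, hA, rfl⟩ := hA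
  let history : (ℕ → S) → (i : Finset.Iic n) → S := Preorder.frestrictLe n
  have hhistory : Measurable history := by fun_prop
  have hlast : Measurable fun h : (i : Finset.Iic n) → S =>
      expect (P (h ⟨n, Finset.mem_Iic.2 le_rfl⟩)) u := hPu.comp (measurable_pi_apply _)
  calc ∫⁻ ω in history ⁻¹' A, u (ω (n + 1)) ∂pathLaw P x₀
      = ∫⁻ p in A ×ˢ Set.univ, u p.2 ∂((pathLaw P x₀).map fun ω => (history ω, ω (n + 1))) := by
        rw [setLIntegral_map (hA.prod .univ) (by fun_prop) (by fun_prop)]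
        simp [Set.mk_preimage_prod]
    _ = ∫⁻ h in A, expect (P (h ⟨n, Finset.mem_Iic.2 le_rfl⟩)) u
          ∂Kernel.partialTraj (X := fun _ => S) (stepKernel P) 0 n (fun _ => x₀) := by
        rw [pathLaw, ← Kernel.partialTraj_compProd_eq_map_traj (Nat.zero_le n),
          Measure.setLIntegral_compProd (by fun_prop) hA .univ]
        simp only [Measure.restrict_univ, ← lintegral_toMeasure]
        rfl
    _ = ∫⁻ ω in history ⁻¹' A, expect (P (ω n)) u ∂pathLaw P x₀ := by
        rw [← Kernel.traj_map_frestrictLe_apply, setLIntegral_map hA hlast hhistory]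
        rfl

lemma setLIntegral_avoiding_pathLaw (x₀ x : S) (n : ℕ) (u : S → ℝ≥0∞) :
    ∫⁻ ω in avoiding x n, u (ω n) ∂pathLaw P x₀ = (taboo P x ^ n) u x₀ := by
  induction n generalizing u with
  | zero => simp [avoiding_zero, lintegral_pathLaw_zero]
  | succ n ih =>
    calc ∫⁻ ω in avoiding x (n + 1), u (ω (n + 1)) ∂pathLaw P x₀
        = ∫⁻ ω in avoiding x n, ({x}ᶜ : Set S).indicator u (ω (n + 1)) ∂pathLaw P x₀ := by
          rw [avoiding_succ, ← setLIntegral_indicator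
            (measurable_pi_apply (n + 1) (.of_discrete (s := {x}ᶜ)))]
          rfl
      _ = ∫⁻ ω in avoiding x n, taboo P x u (ω n) ∂pathLaw P x₀ :=
          setLIntegral_pathLaw_succ P x₀ (measurableSet_piLE_avoiding x n) _
      _ = (taboo P x ^ (n + 1)) u x₀ := by
          rw [ih, pow_succ, Module.End.mul_apply]

lemma meanReturnTime_le {x : S} {B : ℝ≥0∞} (hB : ∀ n, truncReturn P x n x ≤ B) :
    meanReturnTime P x ≤ B :=
  calc meanReturnTime P x
      ≤ ∫⁻ ω, ∑' n, (avoiding x n).indicator 1 ω ∂pathLaw P x :=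
        lintegral_mono (returnTime_le_tsum_indicator_avoiding x)
    _ = ∑' n, (taboo P x ^ n) 1 x := by
        rw [lintegral_tsum fun n =>
          (measurable_one.indicator (measurableSet_avoiding x n)).aemeasurable]
        refine tsum_congr fun n => ?_
        rw [lintegral_indicator (measurableSet_avoiding x n)]
        exact setLIntegral_avoiding_pathLaw P x x n 1
    _ ≤ B := by
        rw [ENNReal.tsum_eq_iSup_nat]
        exact iSup_le fun n => by simpa [truncReturn] using hB n

lemma meanReturnTime_lt_top {V : S → ℝ≥0∞} {F : Finset S} {x : S}
    (hdrift : ∀ y ∉ F, expect (P y) V + 1 ≤ V y) (hV : ∀ y ∈ F, V y ≠ ∞)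
    (hPV : ∀ y ∈ F, expect (P y) V ≠ ∞) (hFx : ∀ y ∈ F, ∃ k, (taboo P x ^ k) 1 y < 1)
    (hx : V x ≠ ∞) : meanReturnTime P x < ∞ := by
  let C := F.sup fun y => expect (P y) V
  have hC : C ≠ ∞ := ((Finset.sup_lt_iff (by simp)).2 fun y hy => (hPV y hy).lt_top).ne
  have hstep (y : S) : expect (P y) V ≤ V y + C := by
    by_cases hy : y ∈ F
    · exact (Finset.le_sup (f := fun y => expect (P y) V) hy).trans le_add_self
    · exact le_self_add.trans ((hdrift y hy).trans le_self_add)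
  obtain ⟨B, hB, hsup⟩ := exists_sup_truncReturn_le hdrift hstep hC hV hFx
  calc meanReturnTime P x
      ≤ V x + B := meanReturnTime_le P fun n =>
        (truncReturn_le_add_sup hdrift x n x).trans (by simpa using add_le_add_right (hsup n) _)
    _ < ∞ := ENNReal.add_lt_top.2 ⟨hx.lt_top, hB.lt_top⟩

end PathLaw

section Reachable

variable {S : Type*} {P : S → PMF S} {x₀ : S}

lemma reachable_of_mem_support {y z : S} (hy : y ∈ reachable P x₀) (hz : z ∈ (P y).support) :
    z ∈ reachable P x₀ :=
  Relation.ReflTransGen.tail hy hz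

lemma IsIrreducibleFrom.transGen (hirr : IsIrreducibleFrom P x₀) {x y : S}
    (hx : x ∈ reachable P x₀) (hy : y ∈ reachable P x₀) :
    Relation.TransGen (fun u v => v ∈ (P u).support) x y := by
  obtain ⟨z, hz⟩ := (P x).support_nonempty
  exact Relation.TransGen.head' hz (hirr z (reachable_of_mem_support hx hz) y hy)

theorem isPositiveRecurrentFrom_of_drift [MeasurableSpace S] [DiscreteMeasurableSpace S]
    (hirr : IsIrreducibleFrom P x₀) {V : S → ℝ≥0∞} {F : Set S} (hF : F.Finite) {ε : ℝ≥0∞}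
    (hε : ε ≠ 0) (hV : ∀ y ∈ reachable P x₀, V y ≠ ∞)
    (hFV : ∀ y ∈ reachable P x₀, y ∈ F → expect (P y) V ≠ ∞)
    (hdrift : ∀ y ∈ reachable P x₀, y ∉ F → expect (P y) V + ε ≤ V y) :
    IsPositiveRecurrentFrom P x₀ := by
  classical
  let δ := min ε 1
  have hδ : δ ≠ 0 := by simp [δ, hε]
  have hδ' : δ ≠ ∞ := ((min_le_right ε 1).trans_lt ENNReal.one_lt_top).ne
  -- With `V = ∞` off the reachable states the drift condition holds at all states.
  let W := (reachable P x₀).piecewise (δ⁻¹ • V) ⊤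
  have hW {y : S} (hy : y ∈ reachable P x₀) : W y = δ⁻¹ * V y :=
    Set.piecewise_eq_of_mem _ _ _ hy
  have hPW {y : S} (hy : y ∈ reachable P x₀) : expect (P y) W = δ⁻¹ * expect (P y) V := by
    rw [← smul_eq_mul, ← map_smul]
    exact expect_congr_support _ fun z hz => hW (reachable_of_mem_support hy hz)
  let E : Finset S := (hF.inter_of_left (reachable P x₀)).toFinset
  have hE {y : S} : y ∈ E ↔ y ∈ F ∧ y ∈ reachable P x₀ := Set.Finite.mem_toFinset _
  intro x hx
  refine meanReturnTime_lt_top P (V := W) (F := E) (fun y hy => ?_) (fun y hy => ?_)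
    (fun y hy => ?_) (fun y hy => ?_) ?_
  · by_cases hyR : y ∈ reachable P x₀
    · rw [hW hyR, hPW hyR, ← ENNReal.inv_mul_cancel hδ hδ', ← mul_add]
      gcongr
      refine (add_le_add_right (min_le_left ε 1) _).trans (hdrift y hyR fun hyF => ?_)
      exact hy (hE.2 ⟨hyF, hyR⟩)
    · have hW_top : W y = ∞ := Set.piecewise_eq_of_notMem _ _ _ hyR
      exact hW_top ▸ le_top
  · have hyR := (hE.1 hy).2
    exact hW hyR ▸ ENNReal.mul_ne_top (ENNReal.inv_ne_top.2 hδ) (hV y hyR)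
  · obtain ⟨hyF, hyR⟩ := hE.1 hy
    exact hPW hyR ▸ ENNReal.mul_ne_top (ENNReal.inv_ne_top.2 hδ) (hFV y hyR hyF)
  · exact exists_taboo_pow_one_lt_one (hirr.transGen (hE.1 hy).2 hx)
  · exact hW hx ▸ ENNReal.mul_ne_top (ENNReal.inv_ne_top.2 hδ) (hV x hx)

end Reachable

end DTMC

/-! ### Drift of the engine -/

namespace LLM

open DTMC

variable {κ : Type*}

section Queue

/-- Number of unprocessed tokens of a request. -/
def Request.tokens (r : Request κ) : ℕ := r.prefill + r.decode

/-- Number of unprocessed tokens of the requests in a list. -/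
def tokens (l : List (Request κ)) : ℕ := (l.map Request.tokens).sum

/-- The largest amount by which a request in the list `l` has more than `L` unprocessed tokens
(`0` if no request has). -/
def maxExcess (L : ℕ) (l : List (Request κ)) : ℕ :=
  (l.map fun r => r.tokens - L : Multiset ℕ).sup

lemma tokens_append (l l' : List (Request κ)) : tokens (l ++ l') = tokens l + tokens l' := by
  simp [tokens]

lemma tokens_filter_le (q : Request κ → Bool) (l : List (Request κ)) :
    tokens (l.filter q) ≤ tokens l :=
  ((l.filter_sublist).map Request.tokens).sum_le_sum fun _ _ => Nat.zero_le _

lemma tokens_ofFn {n : ℕ} (f : Fin n → Request κ) :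
    tokens (List.ofFn f) = ∑ i, (f i).tokens := by
  rw [tokens, List.map_ofFn, List.sum_ofFn]
  rfl

lemma tokens_eq_sum (l : List (Request κ)) : tokens l = ∑ i : Fin l.length, l[i].tokens := by
  conv_lhs => rw [← List.ofFn_getElem (xs := l), tokens_ofFn]
  rfl

lemma maxExcess_le_iff {L n : ℕ} {l : List (Request κ)} :
    maxExcess L l ≤ n ↔ ∀ r ∈ l, r.tokens ≤ n + L := by
  rw [maxExcess, Multiset.sup_le]
  simp

lemma tokens_le_maxExcess_add {L : ℕ} {l : List (Request κ)} {r : Request κ} (hr : r ∈ l) :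
    r.tokens ≤ maxExcess L l + L :=
  maxExcess_le_iff.1 le_rfl r hr

lemma maxExcess_append_le (L : ℕ) (l l' : List (Request κ)) :
    maxExcess L (l ++ l') ≤ maxExcess L l + (tokens l' - L) := by
  refine maxExcess_le_iff.2 fun r hr => ?_
  rcases List.mem_append.1 hr with hr | hr
  · have := tokens_le_maxExcess_add (L := L) hr
    lia
  · have : r.tokens ≤ tokens l' := List.le_sum_of_mem (List.mem_map_of_mem hr)
    lia

end Queue

section Decision

variable {π : Algorithm κ} {x : State κ}

lemma exists_of_mem_postQueue {r : Request κ} (hr : r ∈ postQueue π x) :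
    ∃ i : Fin x.queue.length, r.prefill = x.queue[i].prefill - (π x i).1 ∧
      r.decode = x.queue[i].decode - (π x i).2 ∧ r.decode ≠ 0 := by
  simp only [postQueue, List.mem_filter, List.mem_ofFn, decide_eq_true_eq] at hr
  obtain ⟨⟨i, rfl⟩, hdecode⟩ := hr
  exact ⟨i, rfl, rfl, hdecode⟩

lemma tokens_postQueue_add_tokenLoad_le {b : ℕ} (hfeas : IsFeasibleAt b π x)
    (hdec : ∀ r ∈ x.queue, 1 ≤ r.decode) :
    tokens (postQueue π x) + tokenLoad π x ≤ tokens x.queue := by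
  calc tokens (postQueue π x) + tokenLoad π x
      ≤ ∑ i : Fin x.queue.length,
          ((x.queue[i].prefill - (π x i).1 + (x.queue[i].decode - (π x i).2))
            + ((π x i).1 + (π x i).2)) := by
        rw [Finset.sum_add_distrib]
        exact Nat.add_le_add_right ((tokens_filter_le _ _).trans (tokens_ofFn _).le) _
    _ = tokens x.queue := by
        rw [tokens_eq_sum]
        refine Finset.sum_congr rfl fun i _ => ?_
        have := hfeas.prefill_le i
        have := hfeas.decode_le i
        have := hdec x.queue[i] (List.getElem_mem _)
        rw [Request.tokens]
        lia

lemma maxExcess_postQueue_le (π : Algorithm κ) (x : State κ) (L : ℕ) :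
    maxExcess L (postQueue π x) ≤ maxExcess L x.queue := by
  refine maxExcess_le_iff.2 fun r hr => ?_
  obtain ⟨i, hprefill, hdecode, -⟩ := exists_of_mem_postQueue hr
  calc r.tokens ≤ x.queue[i].tokens := by rw [Request.tokens, Request.tokens]; lia
    _ ≤ maxExcess L x.queue + L := tokens_le_maxExcess_add (List.getElem_mem _)

lemma load_eq_of_tokenLoad_eq_loadable {b : ℕ} (hfeas : IsFeasibleAt b π x)
    (hall : tokenLoad π x = loadable x) (i : Fin x.queue.length) :
    (π x i).1 + (π x i).2 = x.queue[i].prefill + if x.queue[i].prefill = 0 then 1 else 0 := by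
  refine (Finset.sum_eq_sum_iff_of_le fun i _ => ?_).1 hall i (Finset.mem_univ i)
  have := hfeas.prefill_first i
  have := hfeas.prefill_le i
  have := hfeas.decode_le i
  split_ifs <;> lia

lemma maxExcess_postQueue_lt {b L : ℕ} (hfeas : IsFeasibleAt b π x)
    (hdec : ∀ r ∈ x.queue, 1 ≤ r.decode) (hall : tokenLoad π x = loadable x)
    (hpos : maxExcess L x.queue ≠ 0) :
    maxExcess L (postQueue π x) < maxExcess L x.queue := by
  suffices maxExcess L (postQueue π x) ≤ maxExcess L x.queue - 1 by lia
  refine maxExcess_le_iff.2 fun r hr => ?_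
  obtain ⟨i, hprefill, hdecode, hstay⟩ := exists_of_mem_postQueue hr
  have htokens : r.tokens + 1 ≤ x.queue[i].tokens := by
    have := hfeas.prefill_le i
    have := hdec x.queue[i] (List.getElem_mem _)
    have := load_eq_of_tokenLoad_eq_loadable hfeas hall i
    rw [Request.tokens, Request.tokens]
    split_ifs at this <;> lia
  have hmax : x.queue[i].tokens ≤ maxExcess L x.queue + L :=
    tokens_le_maxExcess_add (List.getElem_mem _)
  lia

lemma length_le_loadable (x : State κ) : x.queue.length ≤ loadable x := by
  calc x.queue.length = ∑ _i : Fin x.queue.length, 1 := by simp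
    _ ≤ loadable x := Finset.sum_le_sum fun i _ => by split_ifs <;> lia

/-- The states in which a batch can be formed, fewer than `b` tokens are loadable, and no request
has more than `L` unprocessed tokens: the exceptional set of the drift condition. -/
def lightStates (κ : Type*) (b L : ℕ) : Set (State κ) :=
  {x | x.remaining = 0 ∧ loadable x < b ∧ maxExcess L x.queue = 0}

lemma finite_setOf_tokens_le [Finite κ] (L : ℕ) : {r : Request κ | r.tokens ≤ L}.Finite := by
  let ofSizes (s : Fin 2 × Fin (L + 1) × Fin (L + 1) × κ) : Request κ :=
    ⟨s.1, s.2.1, s.2.2.1, s.2.2.2⟩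
  refine (Set.finite_range ofSizes).subset ?_
  rintro ⟨j, p, d, z⟩ (hr : p + d ≤ L)
  exact ⟨(j, ⟨p, by lia⟩, ⟨d, by lia⟩, z), rfl⟩

lemma finite_lightStates [Finite κ] (b L : ℕ) : (lightStates κ b L).Finite := by
  have := (finite_setOf_tokens_le (κ := κ) L).to_subtype
  refine ((List.finite_length_lt {r : Request κ | r.tokens ≤ L} b).image fun l =>
    (⟨0, l.map Subtype.val⟩ : State κ)).subset ?_
  rintro ⟨_, queue⟩ ⟨rfl, hloadable, hexcess⟩
  lift queue to List {r : Request κ | r.tokens ≤ L} using by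
    simpa using maxExcess_le_iff.1 hexcess.le
  exact ⟨queue, by simpa using (length_le_loadable _).trans_lt hloadable, rfl⟩

end Decision

namespace Engine

variable (M : Engine κ)

section Arrivals

/-- Mean number of tokens arriving per slot, in `[0, ∞]`. -/
noncomputable def eload : ℝ≥0∞ :=
  ∑ j, M.erate j * (M.emeanSize j .prefill + M.emeanSize j .decode)

variable {M} in
lemma FiniteMeans.eload_ne_top (hM : M.FiniteMeans) : M.eload ≠ ∞ :=
  ENNReal.sum_ne_top.2 fun j _ => ENNReal.mul_ne_top (hM.rate j)
    (ENNReal.add_ne_top.2 ⟨hM.size j _, hM.size j _⟩)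

variable {M} in
lemma FiniteMeans.toReal_eload (hM : M.FiniteMeans) :
    M.eload.toReal = ∑ j, M.rate j * (M.meanSize j .prefill + M.meanSize j .decode) := by
  rw [eload, ENNReal.toReal_sum fun j _ => ENNReal.mul_ne_top (hM.rate j)
    (ENNReal.add_ne_top.2 ⟨hM.size j _, hM.size j _⟩)]
  simp only [ENNReal.toReal_mul, ENNReal.toReal_add (hM.size _ _) (hM.size _ _), Engine.rate,
    meanSize]

lemma expect_drawRequests_tokens (types : List (Fin 2)) :
    expect (M.drawRequests types) (fun l => tokens l)
      = ∑ j, types.count j * (M.emeanSize j .prefill + M.emeanSize j .decode) := by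
  induction types with
  | nil => simp [drawRequests, expect_pure, tokens]
  | cons i types ih =>
    have hcons (s : ℕ × ℕ × κ) : expect ((M.drawRequests types).map fun l =>
        (⟨i, s.1, s.2.1, s.2.2⟩ : Request κ) :: l) (fun l => tokens l)
        = (s.1 + s.2.1) + expect (M.drawRequests types) (fun l => tokens l) := by
      rw [expect_map, Function.comp_def]
      simp only [tokens, Request.tokens, List.map_cons, List.sum_cons, Nat.cast_add, expect_add,
        expect_const]
    calc expect (M.drawRequests (i :: types)) (fun l => tokens l)
        = M.emeanSize i .prefill + M.emeanSize i .decode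
            + ∑ j, types.count j * (M.emeanSize j .prefill + M.emeanSize j .decode) := by
          simp only [drawRequests, expect_bind, hcons, expect_add, expect_const, ih]
          rfl
      _ = _ := by
          fin_cases i <;> simp [List.count_cons] <;> ring

lemma expect_newRequests_tokens : expect M.newRequests (fun l => tokens l) = M.eload := by
  calc expect M.newRequests (fun l => tokens l)
      = expect M.arrivalLaw (∑ j, fun types =>
          (M.emeanSize j .prefill + M.emeanSize j .decode) * types.count j) := by
        rw [newRequests, expect_bind]
        congr 1
        ext types
        simp only [expect_drawRequests_tokens, Finset.sum_apply, mul_comm]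
    _ = M.eload := by
        rw [map_sum, eload]
        simp only [expect_const_mul, mul_comm (M.erate _)]
        rfl

lemma one_le_decode_of_mem_drawRequests {types : List (Fin 2)} {l : List (Request κ)}
    (hl : l ∈ (M.drawRequests types).support) : ∀ r ∈ l, 1 ≤ r.decode := by
  induction types generalizing l with
  | nil => simp_all [drawRequests]
  | cons j types ih =>
    simp only [drawRequests, PMF.mem_support_bind_iff, PMF.mem_support_map_iff] at hl
    obtain ⟨s, hs, l, hl, rfl⟩ := hl
    exact List.forall_mem_cons.2 ⟨M.decode_pos j s hs, ih hl⟩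

lemma one_le_decode_of_mem_transition {π : Algorithm κ} {x y : State κ}
    (hy : y ∈ (M.transition π x).support) : ∀ r ∈ y.queue, 1 ≤ r.decode := by
  simp only [transition, newRequests, PMF.mem_support_map_iff, PMF.mem_support_bind_iff] at hy
  obtain ⟨l, ⟨types, -, hl⟩, rfl⟩ := hy
  refine List.forall_mem_append.2 ⟨fun r hr => ?_, M.one_le_decode_of_mem_drawRequests hl⟩
  obtain ⟨i, -, -, hstay⟩ := exists_of_mem_postQueue hr
  exact Nat.one_le_iff_ne_zero.2 hstay

/-- An arbitrary initial state may hold requests without decode tokens; irreducibility makes it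
the successor of another state. -/
lemma one_le_decode_of_reachable {π : Algorithm κ} {x₀ x : State κ}
    (hirr : IsIrreducibleFrom (M.transition π) x₀) (hx : x ∈ reachable (M.transition π) x₀) :
    ∀ r ∈ x.queue, 1 ≤ r.decode := by
  obtain ⟨z, -, hz⟩ := Relation.TransGen.tail'_iff.1 (hirr.transGen hx hx)
  exact M.one_le_decode_of_mem_transition hz

end Arrivals

section Drift

/-- State at the end of a slot, before the new requests are appended. -/
def afterService (π : Algorithm κ) (x : State κ) : State κ :=
  ⟨M.nextRemaining π x, postQueue π x⟩

/-- Lyapunov function: the unprocessed tokens, `β` for each token by which the largest request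
exceeds `L`, and `c` for each slot until the end of the current batch. -/
noncomputable def lyapunov (L : ℕ) (β c : ℝ≥0∞) (x : State κ) : ℝ≥0∞ :=
  tokens x.queue + β * maxExcess L x.queue + c * x.remaining

variable {M} {L : ℕ} {β c : ℝ≥0∞} {π : Algorithm κ} {x : State κ}

lemma lyapunov_ne_top (hβ : β ≠ ∞) (hc : c ≠ ∞) (x : State κ) : lyapunov L β c x ≠ ∞ := by
  simp [lyapunov, ENNReal.mul_eq_top, hβ, hc]

lemma expect_transition_lyapunov_le (π : Algorithm κ) (x : State κ) :
    expect (M.transition π x) (lyapunov L β c) ≤ lyapunov L β c (M.afterService π x)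
      + (M.eload + β * expect M.newRequests (fun l => (tokens l - L : ℕ))) := by
  set x' := M.afterService π x
  have happend (l : List (Request κ)) : lyapunov L β c ⟨x'.remaining, x'.queue ++ l⟩
      ≤ lyapunov L β c x' + (tokens l + β * (tokens l - L : ℕ)) := by
    calc lyapunov L β c ⟨x'.remaining, x'.queue ++ l⟩
        ≤ (tokens x'.queue + tokens l : ℕ)
            + β * (maxExcess L x'.queue + (tokens l - L) : ℕ) + c * x'.remaining := by
          rw [lyapunov, tokens_append]
          gcongr
          exact maxExcess_append_le L x'.queue l
      _ = lyapunov L β c x' + (tokens l + β * (tokens l - L : ℕ)) := by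
          rw [lyapunov]
          push_cast
          ring
  calc expect (M.transition π x) (lyapunov L β c)
      = expect M.newRequests (fun l => lyapunov L β c ⟨x'.remaining, x'.queue ++ l⟩) :=
        expect_map _ _ _
    _ ≤ expect M.newRequests
          (fun l => lyapunov L β c x' + (tokens l + β * (tokens l - L : ℕ))) :=
        expect_mono _ happend
    _ = _ := by
        rw [expect_add, expect_const, expect_add, expect_const_mul, expect_newRequests_tokens]

lemma nextRemaining_of_busy (hbusy : 0 < x.remaining) :
    M.nextRemaining π x + 1 = x.remaining := by
  rw [nextRemaining, if_pos hbusy, Nat.sub_add_cancel hbusy]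

lemma nextRemaining_of_idle (hidle : x.remaining = 0) :
    M.nextRemaining π x + 1 = M.batchTime (tokenLoad π x) := by
  rw [nextRemaining, if_neg hidle.not_gt, Nat.sub_add_cancel (M.batchTime_pos _)]

lemma lyapunov_afterService_add (π : Algorithm κ) (x : State κ) :
    lyapunov L β c (M.afterService π x) + c = tokens (postQueue π x)
      + β * maxExcess L (postQueue π x) + c * (M.nextRemaining π x + 1 : ℕ) := by
  simp only [lyapunov, afterService]
  push_cast
  ring

lemma lyapunov_afterService_add_le_of_busy (hfeas : IsFeasibleAt M.budget π x)
    (hdec : ∀ r ∈ x.queue, 1 ≤ r.decode) (hbusy : 0 < x.remaining) :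
    lyapunov L β c (M.afterService π x) + c ≤ lyapunov L β c x := by
  rw [lyapunov_afterService_add, nextRemaining_of_busy hbusy, lyapunov]
  gcongr
  · exact le_self_add.trans (tokens_postQueue_add_tokenLoad_le hfeas hdec)
  · exact maxExcess_postQueue_le π x L

lemma lyapunov_afterService_add_le_of_full (hfeas : IsFeasibleAt M.budget π x)
    (hdec : ∀ r ∈ x.queue, 1 ≤ r.decode) (hidle : x.remaining = 0)
    (hfull : tokenLoad π x = M.budget) (hc : c * M.batchTime M.budget ≤ M.budget) :
    lyapunov L β c (M.afterService π x) + c ≤ lyapunov L β c x := by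
  have htokens := tokens_postQueue_add_tokenLoad_le hfeas hdec
  rw [hfull] at htokens
  calc lyapunov L β c (M.afterService π x) + c
      = tokens (postQueue π x) + β * maxExcess L (postQueue π x)
          + c * M.batchTime M.budget := by
        rw [lyapunov_afterService_add, nextRemaining_of_idle hidle, hfull]
    _ ≤ tokens (postQueue π x) + β * maxExcess L x.queue + M.budget := by
        gcongr
        exact maxExcess_postQueue_le π x L
    _ = (tokens (postQueue π x) + M.budget : ℕ) + β * maxExcess L x.queue := by
        push_cast
        ring
    _ ≤ tokens x.queue + β * maxExcess L x.queue := by gcongr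
    _ ≤ lyapunov L β c x := le_self_add

lemma lyapunov_afterService_add_le_of_exhaustive (hfeas : IsFeasibleAt M.budget π x)
    (hdec : ∀ r ∈ x.queue, 1 ≤ r.decode) (hidle : x.remaining = 0)
    (hall : tokenLoad π x = loadable x) (hpos : maxExcess L x.queue ≠ 0)
    (hβ : c * M.batchTime (tokenLoad π x) ≤ β) :
    lyapunov L β c (M.afterService π x) + c ≤ lyapunov L β c x := by
  calc lyapunov L β c (M.afterService π x) + c
      ≤ tokens (postQueue π x) + β * maxExcess L (postQueue π x) + β := by
        rw [lyapunov_afterService_add, nextRemaining_of_idle hidle]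
        gcongr
    _ = tokens (postQueue π x) + β * (maxExcess L (postQueue π x) + 1 : ℕ) := by
        push_cast
        ring
    _ ≤ tokens x.queue + β * maxExcess L x.queue := by
        gcongr
        · exact le_self_add.trans (tokens_postQueue_add_tokenLoad_le hfeas hdec)
        · exact maxExcess_postQueue_lt hfeas hdec hall hpos
    _ ≤ lyapunov L β c x := le_self_add

lemma lyapunov_afterService_add_le (hfeas : IsFeasibleAt M.budget π x)
    (hwork : IsWorkConservingAt M.budget π x) (hdec : ∀ r ∈ x.queue, 1 ≤ r.decode)
    (hc : c * M.batchTime M.budget ≤ M.budget) (hβ : ∀ k ≤ M.budget, c * M.batchTime k ≤ β)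
    (hx : x ∉ lightStates κ M.budget L) :
    lyapunov L β c (M.afterService π x) + c ≤ lyapunov L β c x := by
  rcases x.remaining.eq_zero_or_pos with hidle | hbusy
  · rcases le_or_gt M.budget (loadable x) with hmany | hfew
    · exact lyapunov_afterService_add_le_of_full hfeas hdec hidle (hwork.full hidle hmany) hc
    · exact lyapunov_afterService_add_le_of_exhaustive hfeas hdec hidle
        (hwork.exhaustive hidle hfew) (fun hexcess => hx ⟨hidle, hfew, hexcess⟩)
        (hβ _ hfeas.budget)
  · exact lyapunov_afterService_add_le_of_busy hfeas hdec hbusy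

lemma exists_expect_transition_lyapunov_le (hM : M.FiniteMeans) {q : ℝ≥0∞} (hq : M.eload < q)
    (hβ : β ≠ ∞) : ∃ L : ℕ, ∀ c π x, expect (M.transition π x) (lyapunov L β c)
      ≤ lyapunov L β c (M.afterService π x) + q := by
  obtain ⟨L, hL⟩ := exists_expect_tsub_le M.newRequests tokens
    (M.expect_newRequests_tokens ▸ hM.eload_ne_top)
    (ENNReal.div_ne_zero.2 ⟨(tsub_pos_of_lt hq).ne', hβ⟩)
  refine ⟨L, fun c π x => (expect_transition_lyapunov_le π x).trans (add_le_add_right ?_ _)⟩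
  calc M.eload + β * expect M.newRequests (fun l => (tokens l - L : ℕ))
      ≤ M.eload + (q - M.eload) := by
        gcongr
        exact ENNReal.mul_le_of_le_div' hL
    _ = q := add_tsub_cancel_of_le hq.le

end Drift

lemma batchTime_ne_zero (k : ℕ) : (M.batchTime k : ℝ≥0∞) ≠ 0 :=
  Nat.cast_ne_zero.2 (Nat.one_le_iff_ne_zero.1 (M.batchTime_pos k))

theorem isPositiveRecurrentFrom [Finite κ] (hM : M.FiniteMeans)
    (hload : M.eload < M.budget / M.batchTime M.budget) {π : Algorithm κ} {x₀ : State κ}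
    (hπ : ∀ x ∈ reachable (M.transition π) x₀,
      IsFeasibleAt M.budget π x ∧ IsWorkConservingAt M.budget π x)
    (hirr : IsIrreducibleFrom (M.transition π) x₀) :
    IsPositiveRecurrentFrom (M.transition π) x₀ := by
  set c : ℝ≥0∞ := M.budget / M.batchTime M.budget
  have hc_top : c ≠ ∞ := ENNReal.div_ne_top (ENNReal.natCast_ne_top _) (M.batchTime_ne_zero _)
  have hc : c * M.batchTime M.budget ≤ M.budget :=
    (ENNReal.div_mul_cancel (M.batchTime_ne_zero _) (ENNReal.natCast_ne_top _)).le
  let β : ℝ≥0∞ := c * ∑ k ∈ Finset.range (M.budget + 1), (M.batchTime k : ℝ≥0∞)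
  have hβ_top : β ≠ ∞ := ENNReal.mul_ne_top hc_top (by simp)
  have hβ (k : ℕ) (hk : k ≤ M.budget) : c * M.batchTime k ≤ β :=
    mul_le_mul_right (Finset.single_le_sum (f := fun k => (M.batchTime k : ℝ≥0∞))
      (fun _ _ => zero_le) (Finset.mem_range_succ_iff.2 hk)) c
  obtain ⟨q, hloadq, hqc⟩ := exists_between hload
  obtain ⟨L, hstep⟩ := exists_expect_transition_lyapunov_le hM hloadq hβ_top
  have hV (x : State κ) : lyapunov L β c x ≠ ∞ := lyapunov_ne_top hβ_top hc_top x
  refine isPositiveRecurrentFrom_of_drift hirr (finite_lightStates M.budget L)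
    (tsub_pos_of_lt hqc).ne' (fun x _ => hV x) (fun x _ _ => ?_) fun x hx hlight => ?_
  · exact ne_top_of_le_ne_top (ENNReal.add_ne_top.2 ⟨hV _, hqc.ne_top⟩) (hstep c π x)
  · calc expect (M.transition π x) (lyapunov L β c) + (c - q)
        ≤ lyapunov L β c (M.afterService π x) + q + (c - q) := by
          gcongr
          exact hstep c π x
      _ = lyapunov L β c (M.afterService π x) + c := by
          rw [add_assoc, add_tsub_cancel_of_le hqc.le]
      _ ≤ lyapunov L β c x := lyapunov_afterService_add_le (hπ x hx).1 (hπ x hx).2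
          (M.one_le_decode_of_reachable hirr hx) hc hβ hlight

variable {M} in
lemma FiniteMeans.eload_lt (hM : M.FiniteMeans)
    (hload : ∑ j, M.rate j * (M.meanSize j .prefill + M.meanSize j .decode)
      < (M.budget : ℝ) / (M.batchTime M.budget : ℝ)) :
    M.eload < M.budget / M.batchTime M.budget := by
  have htop : (M.budget / M.batchTime M.budget : ℝ≥0∞) ≠ ∞ :=
    ENNReal.div_ne_top (ENNReal.natCast_ne_top _) (M.batchTime_ne_zero _)
  rw [← ENNReal.toReal_lt_toReal hM.eload_ne_top htop, hM.toReal_eload]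
  simpa using hload

end Engine

/-! ### Draining of the fluid model -/

section Fluid

lemma absolutelyContinuousOnInterval_of_eqOn {X : Type*} [PseudoMetricSpace X] {f g : ℝ → X}
    {a b : ℝ} (hf : AbsolutelyContinuousOnInterval f a b) (hgf : Set.EqOn g f (Set.uIcc a b)) :
    AbsolutelyContinuousOnInterval g a b := by
  refine Filter.Tendsto.congr' (Filter.mem_inf_of_right fun E hE => ?_) hf
  exact Finset.sum_congr rfl fun i hi => by rw [hgf (hE.1 i hi).1, hgf (hE.1 i hi).2]

lemma le_sub_mul_of_deriv_le {f : ℝ → ℝ} {a b ε : ℝ} (hab : a ≤ b)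
    (hf : AbsolutelyContinuousOnInterval f a b)
    (hderiv : ∀ᵐ u, u ∈ Set.Icc a b → deriv f u ≤ -ε) : f b ≤ f a - ε * (b - a) := by
  have hmono : ∫ u in a..b, deriv f u ≤ ∫ _ in a..b, -ε :=
    intervalIntegral.integral_mono_ae_restrict hab hf.intervalIntegrable_deriv
      intervalIntegrable_const ((ae_restrict_iff' measurableSet_Icc).2 hderiv)
  rw [hf.integral_deriv_eq_sub, intervalIntegral.integral_const, smul_eq_mul] at hmono
  linarith

lemma le_max_zero_of_deriv_le_of_pos {f : ℝ → ℝ} {a b ε : ℝ} (hab : a ≤ b) (hε : 0 ≤ ε)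
    (hf : AbsolutelyContinuousOnInterval f a b)
    (hderiv : ∀ᵐ u, u ∈ Set.Icc a b → 0 < f u → deriv f u ≤ -ε) :
    f b ≤ max 0 (f a - ε * (b - a)) := by
  have hdecr {s : ℝ} (hs : s ∈ Set.Icc a b) (hpos : ∀ u ∈ Set.Ioc s b, 0 < f u) :
      f b ≤ f s - ε * (b - s) := by
    refine le_sub_mul_of_deriv_le hs.2 (hf.mono ?_) ?_
    · rw [Set.uIcc_of_le hs.2, Set.uIcc_of_le hab]
      exact Set.Icc_subset_Icc_left hs.1
    · filter_upwards [hderiv, Measure.ae_ne volume s] with u hu hus hmem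
      exact hu ⟨hs.1.trans hmem.1, hmem.2⟩ (hpos u ⟨hmem.1.lt_of_ne' hus, hmem.2⟩)
  rcases (Set.Icc a b ∩ f ⁻¹' Set.Iic 0).eq_empty_or_nonempty with hempty | hne
  · refine le_max_of_le_right (hdecr (Set.left_mem_Icc.2 hab) fun u hu => ?_)
    exact not_le.1 fun hfu => hempty.le ⟨Set.Ioc_subset_Icc_self hu, hfu⟩
  · have hcont : ContinuousOn f (Set.Icc a b) := Set.uIcc_of_le hab ▸ hf.continuousOn
    obtain ⟨s, ⟨hs, hfs⟩, hlast⟩ := (isCompact_Icc.of_isClosed_subset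
      (hcont.preimage_isClosed_of_isClosed isClosed_Icc isClosed_Iic)
      Set.inter_subset_left).exists_isGreatest hne
    have hpos (u : ℝ) (hu : u ∈ Set.Ioc s b) : 0 < f u :=
      not_le.1 fun hfu => hu.1.not_ge (hlast ⟨⟨hs.1.trans hu.1.le, hu.2⟩, hfu⟩)
    calc f b ≤ f s - ε * (b - s) := hdecr hs hpos
      _ ≤ 0 := sub_nonpos.2 (hfs.trans (mul_nonneg hε (sub_nonneg.2 hs.2)))
      _ ≤ _ := le_max_left _ _

lemma sum_weighted_pos_iff {w z : Fin 2 → Phase → ℝ} (hw : ∀ j f, 0 < w j f)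
    (hz : ∀ j f, 0 ≤ z j f) :
    0 < ∑ j, (w j .prefill * z j .prefill + w j .decode * z j .decode) ↔
      ∃ j f, 0 < z j f := by
  have hwz (j : Fin 2) (f : Phase) : 0 ≤ w j f * z j f := mul_nonneg (hw j f).le (hz j f)
  rw [Finset.sum_pos_iff_of_nonneg fun j _ => add_nonneg (hwz j _) (hwz j _)]
  simp only [Finset.mem_univ, true_and]
  refine exists_congr fun j => ⟨fun h => ?_, ?_⟩
  · by_contra! hzero
    have := fun f => (hzero f).antisymm (hz j f)
    simp [this] at h
  · rintro ⟨_ | _, h⟩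
    · exact add_pos_of_pos_of_nonneg (mul_pos (hw j _) h) (hwz j _)
    · exact add_pos_of_nonneg_of_pos (hwz j _) (mul_pos (hw j _) h)

/-- Mean number of tokens that a type-`j` request has to process from the phase `f` on. -/
def remainingSize (m : Fin 2 → Phase → ℝ) (j : Fin 2) : Phase → ℝ
  | .prefill => m j .prefill + m j .decode
  | .decode => m j .decode

/-- Total number of tokens processed in a fluid model solution. -/
def FluidPath.work (X : FluidPath) (t : ℝ) : ℝ := ∑ j, (X.B j .prefill t + X.B j .decode t)

/-- Total number of tokens that remain to be processed for the fluid present at time `t`.  Unlike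
the workload `∑ j, ∑ f, W j f t` it counts the decode tokens of the prefill fluid. -/
def FluidPath.backlog (m : Fin 2 → Phase → ℝ) (X : FluidPath) (t : ℝ) : ℝ :=
  ∑ j, (remainingSize m j .prefill * X.Z j .prefill t + remainingSize m j .decode * X.Z j .decode t)

variable {rate : Fin 2 → ℝ} {m : Fin 2 → Phase → ℝ} {c : ℝ} {X : FluidPath}

lemma remainingSize_pos (hm : ∀ j f, 0 < m j f) (j : Fin 2) (f : Phase) :
    0 < remainingSize m j f := by
  cases f with
  | prefill => exact add_pos (hm j _) (hm j _)
  | decode => exact hm j _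

namespace IsFluidSolution

section Regularity

variable (hX : IsFluidSolution rate m c X)
include hX

lemma lipschitzOnWith_B (j : Fin 2) (f : Phase) :
    LipschitzOnWith c.toNNReal (X.B j f) (Set.Ici 0) := by
  refine LipschitzOnWith.of_le_add_mul' c fun s hs t ht => ?_
  rcases le_total t s with hts | hst
  · have := hX.B_rate j f t s ht hts
    rw [Real.dist_eq, abs_of_nonneg (sub_nonneg.2 hts)]
    linarith
  · have hmono := hX.B_mono j f s t hs hst
    have := hmono.trans (hX.B_rate j f s t hs hst)
    rw [dist_comm, Real.dist_eq, abs_of_nonneg (sub_nonneg.2 hst)]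
    linarith

lemma absolutelyContinuousOnInterval_B (j : Fin 2) (f : Phase) {t : ℝ} (ht : 0 ≤ t) :
    AbsolutelyContinuousOnInterval (X.B j f) 0 t :=
  ((hX.lipschitzOnWith_B j f).mono (Set.uIcc_of_le ht ▸ Set.Icc_subset_Ici_self))
    |>.absolutelyContinuousOnInterval

lemma absolutelyContinuousOnInterval_work {t : ℝ} (ht : 0 ≤ t) :
    AbsolutelyContinuousOnInterval X.work 0 t := by
  have hB (j : Fin 2) := (hX.absolutelyContinuousOnInterval_B j .prefill ht).add
    (hX.absolutelyContinuousOnInterval_B j .decode ht)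
  convert! (hB 0).add (hB 1) using 1
  ext u
  simp [FluidPath.work, Fin.sum_univ_two]

lemma isRegular_of_differentiableAt {t : ℝ} (ht : 0 < t)
    (hB : ∀ j f, DifferentiableAt ℝ (X.B j f) t) : X.IsRegular t := by
  have hnonneg : ∀ᶠ u in nhds t, 0 ≤ u := (lt_mem_nhds ht).mono fun _ h => h.le
  have hF (j : Fin 2) (f : Phase) : DifferentiableAt ℝ (X.F j f) t :=
    ((hB j f).const_mul (1 / m j f)).congr_of_eventuallyEq
      (hnonneg.mono fun u hu => hX.F_eq j f u hu)
  have hZ (j : Fin 2) (f : Phase) : DifferentiableAt ℝ (X.Z j f) t := by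
    cases f with
    | prefill =>
      exact (((differentiableAt_id.const_mul (rate j)).const_add _).sub
        (hF j .prefill)).congr_of_eventuallyEq (hnonneg.mono fun u hu => hX.Z_prefill j u hu)
    | decode =>
      exact (((hF j .prefill).const_add _).sub (hF j .decode)).congr_of_eventuallyEq
        (hnonneg.mono fun u hu => hX.Z_decode j u hu)
  have hW (j : Fin 2) (f : Phase) : DifferentiableAt ℝ (X.W j f) t :=
    ((hZ j f).const_mul (m j f)).congr_of_eventuallyEq
      (hnonneg.mono fun u hu => hX.W_eq j f u hu)
  exact ⟨ht, fun j f => ⟨hB j f, hF j f, hW j f, hZ j f⟩⟩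

lemma ae_differentiableAt_B {t : ℝ} (ht : 0 ≤ t) :
    ∀ᵐ u, u ∈ Set.Icc 0 t → ∀ j f, DifferentiableAt ℝ (X.B j f) u := by
  have h (j : Fin 2) (f : Phase) : ∀ᵐ u, u ∈ Set.Icc 0 t → DifferentiableAt ℝ (X.B j f) u :=
    Set.uIcc_of_le ht ▸ (hX.absolutelyContinuousOnInterval_B j f ht).ae_differentiableAt
  filter_upwards [h 0 .prefill, h 0 .decode, h 1 .prefill, h 1 .decode] with u h₁ h₂ h₃ h₄ hu j f
  fin_cases j <;> cases f
  exacts [h₁ hu, h₂ hu, h₃ hu, h₄ hu]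

end Regularity

section Backlog

variable (hX : IsFluidSolution rate m c X) (hm : ∀ j f, 0 < m j f)
include hX hm

lemma backlog_eq {t : ℝ} (ht : 0 ≤ t) :
    X.backlog m t = X.backlog m 0 + (∑ j, rate j * (m j .prefill + m j .decode)) * t
      - X.work t := by
  have hB (j : Fin 2) (f : Phase) : X.B j f t = m j f * X.F j f t := by
    rw [hX.F_eq j f t ht, ← mul_assoc, mul_one_div_cancel (hm j f).ne', one_mul]
  simp only [FluidPath.backlog, FluidPath.work, remainingSize, hB, hX.Z_prefill _ t ht,
    hX.Z_decode _ t ht, Fin.sum_univ_two]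
  ring

lemma backlog_pos_iff {t : ℝ} (ht : 0 ≤ t) : 0 < X.backlog m t ↔ ∃ j f, 0 < X.Z j f t :=
  sum_weighted_pos_iff (remainingSize_pos hm) fun j f => hX.Z_nonneg j f t ht

lemma workload_pos_iff {t : ℝ} (ht : 0 ≤ t) :
    0 < ∑ j, (X.W j .prefill t + X.W j .decode t) ↔ ∃ j f, 0 < X.Z j f t := by
  simp only [hX.W_eq _ _ t ht]
  exact sum_weighted_pos_iff hm fun j f => hX.Z_nonneg j f t ht

lemma backlog_zero_le (hinit : ∑ j, (X.Z j .prefill 0 + X.Z j .decode 0) ≤ 1) :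
    X.backlog m 0 ≤ ∑ j, remainingSize m j .prefill := by
  set A := ∑ j, remainingSize m j .prefill
  have hprefill (j : Fin 2) : remainingSize m j .prefill ≤ A :=
    Finset.single_le_sum (f := fun j => remainingSize m j .prefill)
      (fun j _ => (remainingSize_pos hm j _).le) (Finset.mem_univ j)
  have hdecode (j : Fin 2) : remainingSize m j .decode ≤ A :=
    (le_add_of_nonneg_left (hm j .prefill).le).trans (hprefill j)
  calc X.backlog m 0 ≤ ∑ j, (A * X.Z j .prefill 0 + A * X.Z j .decode 0) := by
        refine Finset.sum_le_sum fun j _ => ?_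
        gcongr
        exacts [hX.Z_nonneg j _ 0 le_rfl, hprefill j, hX.Z_nonneg j _ 0 le_rfl, hdecode j]
    _ = A * ∑ j, (X.Z j .prefill 0 + X.Z j .decode 0) := by simp only [Finset.mul_sum, mul_add]
    _ ≤ A := mul_le_of_le_one_right
        (Finset.sum_nonneg fun j _ => (remainingSize_pos hm j _).le) hinit

lemma deriv_backlog (hwc : X.IsWorkConserving c) {t : ℝ} (ht : 0 < t)
    (hB : ∀ j f, DifferentiableAt ℝ (X.B j f) t) (hpos : 0 < X.backlog m t) :
    deriv (X.backlog m) t = (∑ j, rate j * (m j .prefill + m j .decode)) - c := by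
  have hwork : HasDerivAt X.work c t := by
    rw [← hwc t (hX.isRegular_of_differentiableAt ht hB)
      ((hX.workload_pos_iff hm ht.le).2 ((hX.backlog_pos_iff hm ht.le).1 hpos))]
    exact HasDerivAt.fun_sum fun j _ => (hB j _).hasDerivAt.add (hB j _).hasDerivAt
  have hline := ((hasDerivAt_id t).const_mul
    (∑ j, rate j * (m j .prefill + m j .decode))).const_add (X.backlog m 0)
  rw [mul_one] at hline
  refine ((hline.sub hwork).congr_of_eventuallyEq ?_).deriv
  filter_upwards [lt_mem_nhds ht] with u hu
  exact hX.backlog_eq hm hu.le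

lemma absolutelyContinuousOnInterval_backlog {t : ℝ} (ht : 0 ≤ t) :
    AbsolutelyContinuousOnInterval (X.backlog m) 0 t := by
  have hline : AbsolutelyContinuousOnInterval (fun u => X.backlog m 0
      + (∑ j, rate j * (m j .prefill + m j .decode)) * u) 0 t :=
    (LipschitzWith.const _).lipschitzOnWith.absolutelyContinuousOnInterval.fun_add
      (LipschitzWith.id.lipschitzOnWith.absolutelyContinuousOnInterval.const_mul _)
  refine absolutelyContinuousOnInterval_of_eqOn
    (hline.fun_sub (hX.absolutelyContinuousOnInterval_work ht)) fun u hu => ?_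
  exact hX.backlog_eq hm (Set.uIcc_of_le ht ▸ hu).1

lemma backlog_le (hwc : X.IsWorkConserving c)
    (hload : ∑ j, rate j * (m j .prefill + m j .decode) ≤ c) {t : ℝ} (ht : 0 ≤ t) :
    X.backlog m t
      ≤ max 0 (X.backlog m 0 - (c - ∑ j, rate j * (m j .prefill + m j .decode)) * t) := by
  have h := le_max_zero_of_deriv_le_of_pos ht (sub_nonneg.2 hload)
    (hX.absolutelyContinuousOnInterval_backlog hm ht) ?_
  · simpa using h
  filter_upwards [hX.ae_differentiableAt_B ht, Measure.ae_ne volume 0] with u hB hu0 hu hpos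
  rw [hX.deriv_backlog hm hwc (hu.1.lt_of_ne' hu0) (hB hu) hpos, neg_sub]

end Backlog

end IsFluidSolution

theorem fluidModelStable_of_load_lt (hm : ∀ j f, 0 < m j f)
    (hload : ∑ j, rate j * (m j .prefill + m j .decode) < c) : FluidModelStable rate m c := by
  set ε := c - ∑ j, rate j * (m j .prefill + m j .decode)
  have hε : 0 < ε := sub_pos.2 hload
  set A := ∑ j, remainingSize m j .prefill
  have hA : 0 < A := Finset.sum_pos (fun j _ => remainingSize_pos hm j _) Finset.univ_nonempty
  refine ⟨A / ε, div_pos hA hε, fun X hX hwc hinit t ht j f => ?_⟩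
  have ht0 : 0 ≤ t := (div_pos hA hε).le.trans ht
  have hbacklog : X.backlog m t ≤ 0 := by
    calc X.backlog m t ≤ max 0 (X.backlog m 0 - ε * t) := hX.backlog_le hm hwc hload.le ht0
      _ ≤ max 0 (A - ε * (A / ε)) := by
          gcongr
          exact hX.backlog_zero_le hm hinit
      _ = 0 := by rw [mul_div_cancel₀ _ hε.ne', sub_self, max_self]
  exact (not_lt.1 fun hZ => hbacklog.not_gt ((hX.backlog_pos_iff hm ht0).2 ⟨j, f, hZ⟩)).antisymm
    (hX.Z_nonneg j f t ht0)

end Fluid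

lemma Engine.meanSize_pos {M : Engine κ} (hM : M.FiniteMeans) (j : Fin 2) (f : Phase) :
    0 < M.meanSize j f := by
  have hone : 1 ≤ M.emeanSize j f := by
    rw [← expect_one (M.sizeLaw j)]
    cases f with
    | prefill =>
      exact expect_mono_support _ fun s hs => Nat.one_le_cast.2 (M.prefill_pos j s hs)
    | decode =>
      exact expect_mono_support _ fun s hs => Nat.one_le_cast.2 (M.decode_pos j s hs)
  exact ENNReal.toReal_pos (one_pos.trans_le hone).ne' (hM.size j f)

end LLM

theorem mainTheorem3_general {κ : Type*} [Finite κ] (M : LLM.Engine κ) (hM : M.FiniteMeans)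
    (hload : ∑ j, M.rate j * (M.meanSize j .prefill + M.meanSize j .decode)
      < (M.budget : ℝ) / (M.batchTime M.budget : ℝ)) :
    LLM.FluidModelStable M.rate M.meanSize M.capacity ∧
    ∀ (π : LLM.Algorithm κ) (x₀ : LLM.State κ),
      (∀ x ∈ DTMC.reachable (M.transition π) x₀, LLM.IsFeasibleAt M.budget π x ∧
        LLM.IsWorkConservingAt M.budget π x) →
      DTMC.IsIrreducibleFrom (M.transition π) x₀ →
      DTMC.IsPositiveRecurrentFrom (M.transition π) x₀ :=
  ⟨LLM.fluidModelStable_of_load_lt (LLM.Engine.meanSize_pos hM) hload,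
    fun _ _ => M.isPositiveRecurrentFrom hM (hM.eload_lt hload)⟩

theorem mainTheorem3 {κ : Type*} [Finite κ] (M : LLM.Engine κ) (hM : M.FiniteMeans)
    (hload : ∑ j, M.rate j * (M.meanSize j .prefill + M.meanSize j .decode)
      < (M.budget : ℝ) / (M.batchTime M.budget : ℝ)) :
    LLM.FluidModelStable M.rate M.meanSize M.capacity ∧
    ∀ (Kp Kd : ℕ) (π : LLM.Algorithm κ) (x₀ : LLM.State κ), 1 ≤ Kp → 1 ≤ Kd →
      (∀ x ∈ DTMC.reachable (M.transition π) x₀, LLM.IsFeasibleAt M.budget π x ∧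
        LLM.IsFCFSAt Kp Kd π x ∧ LLM.IsWorkConservingAt M.budget π x) →
      DTMC.IsIrreducibleFrom (M.transition π) x₀ →
      DTMC.IsPositiveRecurrentFrom (M.transition π) x₀ := by
  obtain ⟨hstable, hrec⟩ := mainTheorem3_general M hM hload
  exact ⟨hstable, fun _ _ π x₀ _ _ hπ => hrec π x₀ fun x hx => ⟨(hπ x hx).1, (hπ x hx).2.2⟩⟩
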